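/- For a complex sequence $a=(a_0,a_1,\dots)$ of period $m$ put $C_a(t)=\sum_{i=0}^{m-1}a_i\overline{a_{i+t}}$. For a prime $p$, the sequence is called almost $p$-ary if $a_0=0$ and $a_1,\dots,a_{m-1}$ are powers of a primitive $p$-th root of unity $\zeta_p\in\mathbb C$; it is an almost $p$-ary nearly perfect sequence (NPS) of period $m$ and type $\gamma$ if moreover $C_a(t)=\gamma$ for all $1\le t\le m-1$. For a prime $q$ and an integer $v=q^sw\ge 1$ with $\gcd(q,w)=1$, $q$ is called self-conjugate modulo $v$ if $q^j\equiv-1\pmod w$ for some integer $j$. Write $q^r\,\|\,x$ if $q^r\mid x$ and $q^{r+1}\nmid x$. Theorem 4. Let $p$ be a prime, $n\ge 1$ an integer and $\gamma$ an integer with $|\gamma|<n$. Suppose that there exists an almost $p$-ary NPS of period $n+1$ and type $\gamma$. (i) Let $\gamma=0$. If $q\ne p$ is a prime dividing $n$, $q^r\,\|\,n$, and $q$ is self-conjugate modulo $up$ for some divisor $u\ge 1$ of $n+1$, then $r$ is even and $q^{r/2}\le\frac{n+1}{u}$. (ii) Let $\gamma=-1$. Let $q\ne p$ be a prime dividing $n-\gamma$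 with $q^r\,\|\,n-\gamma$, and let $q$ be self-conjugate modulo $up$ for some divisor $u>1$ of $n+1$. If $q\nmid u$, then $r$ is even and $q^{r/2}\le\frac{n+1}{u}$. If $q\mid u$, then $q^{\lfloor r/2\rfloor}\le 2\,\frac{n+1}{u}$. (iii) Let $\gamma\ne 0$. If $q\ne p$ is a prime dividing $(\gamma+1)n$, $q^r\,\|\,(\gamma+1)n$, and $q$ is self-conjugate modulo $up$ for some divisor $u\ge 1$ of $n+1$ with $q\nmid u$, then $r$ is even. Likewise, if $q\ne p$ is a prime dividing $n-\gamma$, $q^r\,\|\,n-\gamma$, and $q$ is self-conjugate modulo $up$ for some divisor $u>1$ of $n+1$ with $q\nmid u$, then $r$ is even. -/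

import Mathlib

/-- The autocorrelation `C_a(t) = ∑_{i=0}^{m-1} a_i * conj (a_{i+t})` of a complex sequence `a`
of period `m`. -/
noncomputable def autocorrelation (m : ℕ) (a : ℕ → ℂ) (t : ℕ) : ℂ :=
  ∑ i ∈ Finset.range m, a i * (starRingEnd ℂ) (a (i + t))

/-- `a` is an almost `p`-ary sequence of period `m`: it is `m`-periodic, `a 0 = 0`, and the other
entries `a 1, …, a (m - 1)` of a period are powers of a fixed primitive `p`-th root of unity. -/
def IsAlmostAry (p m : ℕ) (a : ℕ → ℂ) : Prop :=
  Function.Periodic a m ∧ a 0 = 0 ∧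
    ∃ ζ : ℂ, IsPrimitiveRoot ζ p ∧ ∀ i : ℕ, 1 ≤ i → i < m → ∃ b : ℤ, a i = ζ ^ b

/-- `a` is an almost `p`-ary nearly perfect sequence of period `m` and type `γ`: all out-of-phase
autocorrelation coefficients are equal to `γ`. -/
def IsAlmostAryNPS (p m : ℕ) (γ : ℤ) (a : ℕ → ℂ) : Prop :=
  IsAlmostAry p m a ∧ ∀ t : ℕ, 1 ≤ t → t < m → autocorrelation m a t = (γ : ℂ)

/-- `q` is self-conjugate modulo `u`: writing `u = q ^ s * w` with `q` coprime to `w`, some power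
of `q` is congruent to `-1` modulo `w`. (As `q` is a unit modulo `w`, natural exponents `j` give
the same powers as integer ones.) -/
def IsSelfConjugateMod (q u : ℕ) : Prop :=
  ∃ s w : ℕ, u = q ^ s * w ∧ Nat.Coprime q w ∧ ∃ j : ℕ, (q : ℤ) ^ j ≡ -1 [ZMOD (w : ℤ)]

/-- `q ^ r` exactly divides the integer `x`: `q ^ r ∣ x` but not `q ^ (r + 1) ∣ x`. -/
def ExactlyDivides (q r : ℕ) (x : ℤ) : Prop :=
  (q : ℤ) ^ r ∣ x ∧ ¬ (q : ℤ) ^ (r + 1) ∣ x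

/-! Let `ω` have order `u * p` and `η = ω ^ p`. The character sums `χ k = ∑ a i * η ^ (k * i)` lie
in `ℤ[ω]`, and `|χ k|²` is the Fourier transform of the autocorrelation: `(γ + 1) * n` if `η ^ k =
1`, else `n - γ`. Self-conjugacy makes conjugation a power of Frobenius modulo the primes above `q`,
so a factor `q ^ r` of `|χ k|²` is shared evenly between `χ k` and its conjugate
(`exists_eq_pow_mul_of_mul_conj`). If `q ∤ u`, then `q ^ ⌈r/2⌉ ∣ χ k`, so an odd `r` would force `q
^ (r + 1)` into `|χ k|²`. In general `q ^ ⌊r/2⌋ ∣ χ k`.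

For the bounds, Fourier inversion recovers the sums `B y` of `a` over the classes `-y` modulo `u`,
each having `(n + 1) / u` terms. If `q ∤ u`, the power of `q` passes to every `B y`; if it exceeded
the number of terms, all conjugates of `B y` would be too small, so `B y = 0` and `χ 1 = 0`. If `q ∣
u`, dividing by `u` would lose powers of `q`. The differences `B y - B (y + u / q)` avoid this: the
characters with `q ∣ k` cancel, and Galois traces over the others supply the missing factor. Having
twice as many terms costs the factor 2. -/

open Polynomial

/-! ### Self-conjugate primes and divisibility in cyclotomic rings. -/

/-- If complex conjugation on `R` agrees modulo `π` with a power of the Frobenius map, and a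
positive power of the Frobenius map is trivial modulo `π`, then `π ∣ x * conj x` forces `π ∣ x`. -/
theorem dvd_of_dvd_mul_conj {R : Type*} [CommRing R] {g : R}
    (hg : Function.Surjective (aeval g : ℤ[X] →ₐ[ℤ] R)) (conj : R →+* R) (hconj : conj g * g = 1)
    {q w j : ℕ} (hq : q.Prime) {π : R} (hπq : π ∣ (q : R)) (hgw : π ∣ g ^ w - 1)
    (hcop : q.Coprime w) (hj : (q : ℤ) ^ j ≡ -1 [ZMOD (w : ℤ)]) {x : R} (h : π ∣ x * conj x) :
    π ∣ x := by
  have : Fact q.Prime := ⟨hq⟩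
  set mk := Ideal.Quotient.mk (Ideal.span {π}) with hmk
  have hz : ∀ y : R, mk y = 0 ↔ π ∣ y := fun y => by
    rw [hmk, Ideal.Quotient.eq_zero_iff_mem, Ideal.mem_span_singleton]
  rw [← hz]
  rcases subsingleton_or_nontrivial (R ⧸ Ideal.span {π}) with hS | hS
  · exact Subsingleton.elim _ _
  have hq0 : ((q : ℕ) : R ⧸ Ideal.span {π}) = 0 := by
    rw [← map_natCast mk]; exact (hz _).2 hπq
  have : CharP (R ⧸ Ideal.span {π}) q := (CharP.charP_iff_prime_eq_zero hq).2 hq0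
  have hgw1 : mk g ^ w = 1 := by
    have := (hz _).2 hgw
    rwa [map_sub, map_pow, map_one, sub_eq_zero] at this
  have ext : ∀ f₁ f₂ : R →+* (R ⧸ Ideal.span {π}), f₁ g = f₂ g → f₁ = f₂ := by
    intro f₁ f₂ h12
    have : f₁.comp (aeval g : ℤ[X] →ₐ[ℤ] R).toRingHom = f₂.comp (aeval g).toRingHom :=
      Polynomial.ringHom_ext (by simp) (by simpa using h12)
    ext y
    obtain ⟨P, rfl⟩ := hg y
    exact RingHom.congr_fun this P
  have hw : 0 < w := by
    rcases Nat.eq_zero_or_pos w with h0 | h0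
    · subst h0; exact absurd ((Nat.coprime_zero_right q).1 hcop) hq.one_lt.ne'
    · exact h0
  have pw : ∀ e : ℕ, e ≡ 1 [MOD w] → mk g ^ e = mk g := by
    intro e he
    rw [← pow_mod_orderOf, he.of_dvd (orderOf_dvd_of_pow_eq_one hgw1), pow_mod_orderOf, pow_one]
  -- The `φ(w)`-th iterate of Frobenius fixes the generator, hence everything; so the quotient has
  -- no nonzero nilpotents.
  have hfix : ∀ k : ℕ, mk x ^ q ^ (w.totient * k) = mk x := by
    intro k
    have := ext ((iterateFrobenius _ q (w.totient * k)).comp mk) mk (by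
      simp only [RingHom.comp_apply, iterateFrobenius_def]
      apply pw
      rw [pow_mul]
      simpa using (Nat.ModEq.pow_totient hcop).pow k)
    simpa [iterateFrobenius_def] using RingHom.congr_fun this x
  have hc : mk (conj x) = mk x ^ q ^ j := by
    have := ext (mk.comp conj) ((iterateFrobenius _ q j).comp mk) (by
      simp only [RingHom.comp_apply, iterateFrobenius_def]
      have h1 : mk (conj g) * mk g = 1 := by rw [← map_mul, hconj, map_one]
      have h2 : mk g ^ (q ^ j) * mk g = 1 := by
        rw [← pow_succ]
        have : w ∣ q ^ j + 1 := by
          have := (Int.modEq_iff_dvd.1 hj.symm)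
          zify; simpa using this
        obtain ⟨c, hc⟩ := this
        rw [hc, pow_mul, hgw1, one_pow]
      calc mk (conj g) = mk (conj g) * (mk g ^ (q ^ j) * mk g) := by rw [h2, mul_one]
        _ = (mk (conj g) * mk g) * mk g ^ (q ^ j) := by ring
        _ = _ := by rw [h1, one_mul])
    simpa [iterateFrobenius_def] using RingHom.congr_fun this x
  have hnil : mk x ^ (q ^ j + 1) = 0 := by
    rw [pow_succ, ← hc, mul_comm, ← map_mul]; exact (hz _).2 h
  rw [← hfix (q ^ j + 1)]
  refine pow_eq_zero_of_le ?_ hnil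
  calc q ^ j + 1 ≤ q ^ (q ^ j + 1) := (Nat.lt_pow_self hq.one_lt).le
    _ ≤ _ := Nat.pow_le_pow_right hq.pos (Nat.le_mul_of_pos_left _ (Nat.totient_pos.2 hw))

/-- Descent on `l`: once `π ∣ x`, the product contains `π * conj π`, an associate of `π ^ 2`, which
can be cancelled. -/
theorem pow_dvd_of_pow_dvd_mul_conj {R : Type*} [CommRing R] [IsDomain R] (conj : R →+* R) {π : R}
    (hπ : π ≠ 0) (hcπ : Associated (conj π) π)
    (hrad : ∀ x : R, π ∣ x * conj x → π ∣ x) :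
    ∀ (l : ℕ) (x : R), π ^ l ∣ x * conj x → π ^ ((l + 1) / 2) ∣ x
  | 0, x, _ => by simp
  | 1, x, h => by simpa using hrad x (by simpa using h)
  | l + 2, x, h => by
    obtain ⟨y, rfl⟩ := hrad x ((Dvd.intro_left _ (pow_succ π (l + 1)).symm).trans h)
    have : π ^ l ∣ y * conj y := by
      obtain ⟨u, hu⟩ := hcπ
      have h1 : π ^ l * (π * conj π) ∣ (y * conj y) * (π * conj π) := by
        refine (Dvd.dvd.trans ?_ h).trans (dvd_of_eq ?_)
        · exact ⟨u, by linear_combination (-(π ^ l * π)) * hu⟩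
        · rw [map_mul]; ring
      refine (mul_dvd_mul_iff_right ?_).1 h1
      refine mul_ne_zero hπ fun h0 => hπ ?_
      rw [← hu, h0, zero_mul]
    have h2 := pow_dvd_of_pow_dvd_mul_conj conj hπ hcπ hrad l y this
    have h3 : (l + 2 + 1) / 2 = (l + 1) / 2 + 1 := by omega
    rw [h3, pow_succ']
    exact mul_dvd_mul_left π h2

/-- Total ramification: `q` is the value at 1 of the cyclotomic polynomial, and its factors `1 - μ`
are all associates. -/
theorem IsPrimitiveRoot.associated_sub_one_pow_totient {R : Type*} [CommRing R] [IsDomain R]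
    {ψ : R} {q b : ℕ} (hq : q.Prime) (hψ : IsPrimitiveRoot ψ (q ^ (b + 1))) :
    Associated ((ψ - 1) ^ (q ^ (b + 1)).totient) (q : R) := by
  have : Fact q.Prime := ⟨hq⟩
  have h1 : (q : R) = ∏ μ ∈ primitiveRoots (q ^ (b + 1)) R, (1 - μ) := by
    rw [← eval_one_cyclotomic_prime_pow (R := R) (p := q) b,
      cyclotomic_eq_prod_X_sub_primitiveRoots hψ, eval_prod]
    simp
  rw [h1, ← hψ.card_primitiveRoots, ← Finset.prod_const]
  refine Associated.prod _ _ _ fun μ hμ => ?_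
  obtain ⟨i, -, hi, rfl⟩ := (hψ.isPrimitiveRoot_iff (k := q ^ (b + 1))).1
    ((mem_primitiveRoots (pow_pos hq.pos _)).1 hμ)
  have := hψ.associated_sub_one_pow_sub_one_of_coprime hi
  exact this.trans ⟨-1, by simp⟩

theorem Int.dvd_of_cast_eq_mul_isIntegral {d k : ℤ} (hd : d ≠ 0) {β : ℂ} (hβ : IsIntegral ℤ β)
    (h : (k : ℂ) = d * β) : d ∣ k := by
  have hd' : (d : ℂ) ≠ 0 := by exact_mod_cast hd
  have h1 : β = algebraMap ℚ ℂ ((k : ℚ) / d) := by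
    simp only [map_div₀, map_intCast]
    rw [h]; field_simp
  rw [h1, isIntegral_algebraMap_iff (algebraMap ℚ ℂ).injective] at hβ
  obtain ⟨y, hy⟩ := IsIntegrallyClosed.isIntegral_iff.1 hβ
  refine ⟨y, ?_⟩
  have : (d : ℚ) ≠ 0 := by exact_mod_cast hd
  simp only [algebraMap_int_eq, eq_intCast] at hy
  field_simp at hy
  have : (k : ℚ) = d * y := by rw [← hy]; ring
  exact_mod_cast this

/-- For `b = 0` the descent runs with `π = q`. Otherwise `q` ramifies and `π = ω ^ w - 1` is used,
with `q` an associate of `π ^ e`, `e = φ(q ^ b)`; only whole powers of `q` are kept, hence the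
rounding down. -/
theorem IsPrimitiveRoot.exists_eq_pow_mul_of_mul_conj {ω : ℂ} {N q w j b : ℕ}
    (hω : IsPrimitiveRoot ω N) (hq : q.Prime) (hN : N = q ^ b * w) (hcop : q.Coprime w)
    (hj : (q : ℤ) ^ j ≡ -1 [ZMOD (w : ℤ)]) {C : ℤ[X]} {K : ℤ}
    (hC : aeval ω C * (starRingEnd ℂ) (aeval ω C) = (K : ℂ)) {r : ℕ} (hr : (q : ℤ) ^ r ∣ K) :
    ∃ P : ℤ[X], aeval ω C = (q : ℂ) ^ (if b = 0 then (r + 1) / 2 else r / 2) * aeval ω P := by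
  have hw : w ≠ 0 := by
    rintro rfl
    exact hq.one_lt.ne' ((Nat.coprime_zero_right q).1 hcop)
  have hN0 : N ≠ 0 := hN ▸ mul_ne_zero (pow_ne_zero _ hq.ne_zero) hw
  set R := (aeval ω : ℤ[X] →ₐ[ℤ] ℂ).range with hR
  let g : R := ⟨ω, X, by simp⟩
  have hcoe : ∀ P : ℤ[X], ((aeval g P : R) : ℂ) = aeval ω P := fun P =>
    (Subalgebra.aeval_coe R g P).symm
  have hg : Function.Surjective (aeval g : ℤ[X] →ₐ[ℤ] R) := by
    rintro ⟨_, P, rfl⟩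
    exact ⟨P, Subtype.ext (hcoe P)⟩
  have hconj1 : (starRingEnd ℂ) ω * ω = 1 := by
    rw [mul_comm, Complex.mul_conj, Complex.normSq_eq_norm_sq, hω.norm'_eq_one hN0]; simp
  have hmem : ∀ x : R, (starRingEnd ℂ) (x : ℂ) ∈ R := by
    rintro ⟨_, P, rfl⟩
    refine ⟨P.comp (X ^ (N - 1)), ?_⟩
    have h1 : (starRingEnd ℂ) ω = ω ^ (N - 1) := by
      calc (starRingEnd ℂ) ω = (starRingEnd ℂ) ω * ω ^ N := by rw [hω.pow_eq_one, mul_one]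
        _ = ((starRingEnd ℂ) ω * ω) * ω ^ (N - 1) := by
          rw [mul_assoc, ← pow_succ', Nat.sub_add_cancel (Nat.pos_of_ne_zero hN0)]
        _ = _ := by rw [hconj1, one_mul]
    have h2 := Polynomial.hom_eval₂ P (algebraMap ℤ ℂ) (starRingEnd ℂ) ω
    simp only [AlgHom.toRingHom_eq_coe, RingHom.coe_coe, aeval_comp, map_pow, aeval_X]
    rw [← h1, aeval_def, aeval_def, h2]
    congr 1
    exact Subsingleton.elim _ _
  let conj : R →+* R := ((starRingEnd ℂ).comp R.subtype).codRestrict R hmem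
  have hconj : ∀ x : R, ((conj x : R) : ℂ) = (starRingEnd ℂ) (x : ℂ) := fun x => rfl
  have hconjg : conj g * g = 1 := Subtype.ext hconj1
  have hgprim : IsPrimitiveRoot g N :=
    IsPrimitiveRoot.of_map_of_injective (f := R.subtype) hω Subtype.val_injective
  have hq0 : (q : R) ≠ 0 := by exact_mod_cast hq.ne_zero
  have hdvd : (q : R) ^ r ∣ aeval g C * conj (aeval g C) := by
    have : aeval g C * conj (aeval g C) = (K : R) := by
      apply Subtype.ext
      push_cast
      rw [hconj, hcoe, hC]
    rw [this]
    exact_mod_cast (Int.castRingHom R).map_dvd hr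
  have key : (q : R) ^ (if b = 0 then (r + 1) / 2 else r / 2) ∣ aeval g C := by
    rcases b with _ | b
    · rw [if_pos rfl]
      refine pow_dvd_of_pow_dvd_mul_conj conj hq0 ?_ ?_ r _ hdvd
      · rw [map_natCast]
      · intro x hx
        refine dvd_of_dvd_mul_conj hg conj hconjg hq dvd_rfl ?_ hcop hj hx
        have : g ^ w = 1 := by
          rw [← hgprim.pow_eq_one, hN]; simp
        simp [this]
    · rw [if_neg (Nat.succ_ne_zero b)]
      have hψ : IsPrimitiveRoot (g ^ w) (q ^ (b + 1)) :=
        hgprim.pow (Nat.pos_of_ne_zero hN0) (by rw [hN, mul_comm])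
      have hass := hψ.associated_sub_one_pow_totient hq
      set e := (q ^ (b + 1)).totient with he
      have he0 : e ≠ 0 := (Nat.totient_pos.2 (pow_pos hq.pos _)).ne'
      have hπ0 : g ^ w - 1 ≠ 0 := by
        intro h0
        rw [h0, zero_pow he0] at hass
        exact hq0 (hass.eq_zero_iff.1 rfl)
      have hcπ : Associated (conj (g ^ w - 1)) (g ^ w - 1) := by
        have h1 : (conj g) ^ w * g ^ w = 1 := by rw [← mul_pow, hconjg, one_pow]
        rw [map_sub, map_pow, map_one]
        exact associated_of_dvd_dvd ⟨-g ^ w, by linear_combination h1⟩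
          ⟨-(conj g) ^ w, by linear_combination h1⟩
      have h2 : (g ^ w - 1) ^ (e * r) ∣ aeval g C * conj (aeval g C) := by
        rw [pow_mul]
        exact (pow_dvd_pow_of_dvd hass.dvd r).trans hdvd
      have h3 := pow_dvd_of_pow_dvd_mul_conj conj hπ0 hcπ
        (fun x hx => dvd_of_dvd_mul_conj hg conj hconjg hq
          ((dvd_pow_self _ he0).trans hass.dvd) dvd_rfl hcop hj hx) _ _ h2
      refine (pow_dvd_pow_of_dvd hass.symm.dvd (r / 2)).trans ?_
      rw [← pow_mul]
      refine (pow_dvd_pow _ ?_).trans h3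
      rw [Nat.le_div_iff_mul_le (by norm_num), mul_assoc]
      exact (Nat.mul_le_mul_left e (Nat.div_mul_le_self r 2)).trans (Nat.le_succ _)
  obtain ⟨y, hy⟩ := key
  obtain ⟨P, rfl⟩ := hg y
  refine ⟨P, ?_⟩
  rw [← hcoe, ← hcoe, hy]
  push_cast
  rfl

theorem IsPrimitiveRoot.isIntegral_aeval {A : Type*} [CommRing A] {ω : A} {N : ℕ}
    (hω : IsPrimitiveRoot ω N) (hN : 0 < N) (P : ℤ[X]) : IsIntegral ℤ (aeval ω P) := by
  have h := Subalgebra.aeval_coe (integralClosure ℤ A) ⟨ω, hω.isIntegral hN⟩ P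
  rw [show aeval ω P = _ from h]
  exact Subtype.property _

theorem IsPrimitiveRoot.even_of_mul_conj {ω : ℂ} {N q j : ℕ}
    (hω : IsPrimitiveRoot ω N) (hq : q.Prime) (hcop : q.Coprime N)
    (hj : (q : ℤ) ^ j ≡ -1 [ZMOD (N : ℤ)]) {C : ℤ[X]} {K : ℤ}
    (hC : aeval ω C * (starRingEnd ℂ) (aeval ω C) = (K : ℂ)) {r : ℕ}
    (hr : ExactlyDivides q r K) : Even r := by
  have hN : 0 < N := by
    rcases Nat.eq_zero_or_pos N with rfl | h
    · exact absurd ((Nat.coprime_zero_right q).1 hcop) hq.one_lt.ne'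
    · exact h
  obtain ⟨P, hP⟩ := hω.exists_eq_pow_mul_of_mul_conj (b := 0) hq (by simp) hcop hj hC hr.1
  rw [if_pos rfl] at hP
  by_contra hodd
  obtain ⟨s, rfl⟩ := Nat.not_even_iff_odd.1 hodd
  have hs : (2 * s + 1 + 1) / 2 = s + 1 := by omega
  apply hr.2
  refine Int.dvd_of_cast_eq_mul_isIntegral (pow_ne_zero _ (by exact_mod_cast hq.ne_zero))
    (β := aeval ω P * (starRingEnd ℂ) (aeval ω P)) ?_ ?_
  · have h1 := hω.isIntegral_aeval hN P
    exact h1.mul (h1.map ((starRingEnd ℂ).toIntAlgHom))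
  · rw [← hC, hP, hs]
    simp only [map_mul, map_pow, Complex.conj_natCast]
    push_cast
    ring

/-! ### Conjugates of elements of `ℤ[ω]`. -/

/-- If an integer combination `C ω` of powers of `ω` is a multiple of `m` in `ℤ[ω]`, while all
its conjugates are smaller than `m`, then it vanishes. -/
theorem IsPrimitiveRoot.aeval_eq_zero_of_norm_lt {ω : ℂ} {N : ℕ} (hω : IsPrimitiveRoot ω N)
    (hN : 0 < N) {C P : ℤ[X]} {m : ℕ} (h : aeval ω C = m * aeval ω P)
    (hlt : ∀ ω' : ℂ, IsPrimitiveRoot ω' N → ‖aeval ω' C‖ < m) : aeval ω C = 0 := by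
  have hint : IsIntegral ℚ ω := (hω.isIntegral hN).tower_top
  have : FiniteDimensional ℚ (IntermediateField.adjoin ℚ {ω}) :=
    IntermediateField.adjoin.finiteDimensional hint
  have : NumberField (IntermediateField.adjoin ℚ {ω}) := { }
  set K := IntermediateField.adjoin ℚ {ω} with hK
  let g : K := IntermediateField.AdjoinSimple.gen ℚ ω
  have hgω : algebraMap K ℂ g = ω := IntermediateField.AdjoinSimple.algebraMap_gen ℚ ω
  have hgp : IsPrimitiveRoot g N := by
    rw [← hgω] at hω
    exact hω.of_map_of_injective (algebraMap K ℂ).injective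
  have hcoe : ∀ (φ : K →+* ℂ) (Q : ℤ[X]), φ (aeval g Q) = aeval (φ g) Q := by
    intro φ Q
    exact (Polynomial.aeval_algHom_apply φ.toIntAlgHom g Q).symm
  have hβ : aeval g C = m * aeval g P := by
    apply (algebraMap K ℂ).injective
    rw [map_mul, map_natCast, hcoe, hcoe, hgω, h]
  have hm : (0 : ℝ) < m := (norm_nonneg _).trans_lt (hlt ω hω)
  have hP0 : aeval g P = 0 := by
    by_contra hne
    have hi : IsIntegral ℤ (aeval g P) :=
      hgp.isIntegral_aeval hN P
    -- A nonzero algebraic integer has a conjugate of absolute value at least 1.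
    obtain ⟨σ, hσ⟩ := NumberField.exists_conjugate_one_le_norm
      (α := (⟨aeval g P, hi⟩ : NumberField.RingOfIntegers K))
      (fun h0 => hne (congrArg Subtype.val h0))
    have h1 := hlt (σ g) (hgp.map_of_injective σ.injective)
    rw [← hcoe, hβ, map_mul, norm_mul, map_natCast, Complex.norm_natCast] at h1
    have h2 : (1 : ℝ) ≤ ‖σ (aeval g P)‖ := hσ
    nlinarith
  rw [← hgω, ← hcoe, hβ, hP0, mul_zero, map_zero]

/-- Polynomial relations over `ℤ` satisfied by `ω` are satisfied by all its conjugates. -/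
theorem IsPrimitiveRoot.aeval_pow_eq_mul {ω : ℂ} {N : ℕ} (hω : IsPrimitiveRoot ω N)
    (hN : 0 < N) {C P : ℤ[X]} {m : ℂ} {k : ℤ} (hm : m = k) (h : aeval ω C = m * aeval ω P)
    {a : ℕ} (ha : a.Coprime N) : aeval (ω ^ a) C = m * aeval (ω ^ a) P := by
  subst hm
  have h0 : aeval ω (C - Polynomial.C k * P) = 0 := by simp [h]
  have hd : minpoly ℤ ω ∣ C - Polynomial.C k * P := minpoly.isIntegrallyClosed_dvd
    (hω.isIntegral hN) h0
  rw [← cyclotomic_eq_minpoly hω hN, cyclotomic_eq_minpoly (hω.pow_of_coprime a ha) hN] at hd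
  obtain ⟨Q, hQ⟩ := hd
  have := congrArg (aeval (ω ^ a)) hQ
  simp only [map_mul, minpoly.aeval, zero_mul, map_sub, eq_intCast, map_intCast] at this
  exact sub_eq_zero.1 this

/-! ### Fourier analysis modulo `u`. -/

theorem IsPrimitiveRoot.sum_range_pow_pow {η : ℂ} {u : ℕ} (hη : IsPrimitiveRoot η u) (j : ℕ) :
    ∑ k ∈ Finset.range u, (η ^ j) ^ k = if u ∣ j then (u : ℂ) else 0 := by
  split_ifs with h
  · rw [(hη.pow_eq_one_iff_dvd j).2 h]; simp
  · have h1 : η ^ j ≠ 1 := fun h' => h ((hη.pow_eq_one_iff_dvd j).1 h')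
    rw [geom_sum_eq h1, ← pow_mul, mul_comm, pow_mul, hη.pow_eq_one, one_pow, sub_self, zero_div]

theorem exists_sum_range_ite_dvd {u : ℕ} (hu : 0 < u) (c : ℕ) :
    ∃ y < u, u ∣ c + y ∧ ∀ g : ℕ → ℂ,
      ∑ k ∈ Finset.range u, (if u ∣ c + k then g k else 0) = g y := by
  have hlt := Nat.mod_lt c hu
  have hy : u ∣ c + (u - c % u) % u := by
    rw [Nat.dvd_iff_mod_eq_zero, Nat.add_mod, Nat.mod_mod, Nat.add_mod_mod,
      Nat.add_sub_cancel' hlt.le, Nat.mod_self]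
  refine ⟨(u - c % u) % u, Nat.mod_lt _ hu, hy, fun g => ?_⟩
  rw [Finset.sum_eq_single_of_mem _ (Finset.mem_range.2 (Nat.mod_lt (u - c % u) hu)), if_pos hy]
  intro k hk hne
  rw [if_neg]
  intro hdvd
  apply hne
  have h1 : c + k ≡ c + (u - c % u) % u [MOD u] :=
    (Nat.modEq_zero_iff_dvd.2 hdvd).trans (Nat.modEq_zero_iff_dvd.2 hy).symm
  exact (Nat.ModEq.add_left_cancel' c h1).eq_of_lt_of_lt (Finset.mem_range.1 hk) (Nat.mod_lt _ hu)

theorem card_filter_range_dvd_add {u : ℕ} (hu : 0 < u) (M y : ℕ) :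
    ((Finset.range (M * u)).filter fun i => u ∣ i + y).card = M := by
  have h : ∑ i ∈ Finset.range (M * u), (if u ∣ i + y then (1 : ℂ) else 0) = M := by
    induction M with
    | zero => simp
    | succ M ih =>
      rw [Nat.succ_mul, Finset.sum_range_add, ih]
      obtain ⟨_, -, -, h⟩ := exists_sum_range_ite_dvd hu y
      have h1 : ∀ x, u ∣ M * u + x + y ↔ u ∣ y + x := fun x => by
        rw [add_assoc, Nat.dvd_add_right (Dvd.intro_left M rfl), add_comm]
      simp only [h1, h (fun _ => 1)]
      push_cast; ring
  rw [Finset.sum_boole] at h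
  exact_mod_cast h

/-- Fourier inversion. The exponents `k` are left arbitrary, subject to orthogonality, so that the
case `q ∣ u` can use a system of residues adapted to the Galois action. -/
theorem sum_characterSum_mul_eq {ι : Type*} {S : Finset ι} {k : ι → ℕ} {η : ℂ} {u : ℕ}
    (hk : ∀ j, ∑ x ∈ S, η ^ (k x * j) = if u ∣ j then (u : ℂ) else 0) (a : ℕ → ℂ) (m y : ℕ) :
    ∑ x ∈ S, η ^ (k x * y) * ∑ i ∈ Finset.range m, a i * η ^ (k x * i) =
      u * ∑ i ∈ (Finset.range m).filter (fun i => u ∣ i + y), a i := by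
  simp_rw [Finset.mul_sum]
  rw [Finset.sum_comm, Finset.sum_filter]
  refine Finset.sum_congr rfl fun i _ => ?_
  calc _ = a i * ∑ x ∈ S, η ^ (k x * (i + y)) := by
        rw [Finset.mul_sum]
        refine Finset.sum_congr rfl fun x _ => ?_
        rw [mul_add, pow_add]; ring
    _ = _ := by rw [hk]; split_ifs <;> ring

/-- The shift `c` turns periodicity of the fibre sums into an equation `η ^ c * χ 1 = χ 1`. -/
theorem IsPrimitiveRoot.sum_inv_pow_mul_fiberSum {η : ℂ} {u : ℕ} (hη : IsPrimitiveRoot η u)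
    (hu : 0 < u) (a : ℕ → ℂ) (m c : ℕ) :
    ∑ y ∈ Finset.range u,
        (η ^ y)⁻¹ * ∑ i ∈ (Finset.range m).filter (fun i => u ∣ i + (y + c)), a i =
      η ^ c * ∑ i ∈ Finset.range m, a i * η ^ i := by
  simp_rw [Finset.sum_filter, Finset.mul_sum]
  rw [Finset.sum_comm]
  refine Finset.sum_congr rfl fun i _ => ?_
  obtain ⟨y, -, hy, hsum⟩ := exists_sum_range_ite_dvd hu (i + c)
  have h1 : ∀ x, i + (x + c) = i + c + x := fun x => by ring
  simp_rw [h1, mul_ite, mul_zero]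
  rw [hsum (fun x => (η ^ x)⁻¹ * a i)]
  have h2 : η ^ (i + c) * η ^ y = 1 := by
    rw [← pow_add]; exact (hη.pow_eq_one_iff_dvd _).2 hy
  rw [← eq_inv_of_mul_eq_one_left h2, pow_add]
  ring

/-- A sum of the conjugates of `E ω` over the exponents congruent to `1` modulo `w` is divisible
by the number of these exponents. -/
theorem IsPrimitiveRoot.exists_sum_aeval_eq_mul {ω : ℂ} {Q w : ℕ}
    (hω : IsPrimitiveRoot ω (Q * w)) (hQw : 0 < Q * w) (E : ℤ[X]) :
    ∃ P : ℤ[X], ∑ s ∈ Finset.range Q, aeval (ω ^ (1 + w * s)) E = Q * aeval ω P := by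
  induction E using Polynomial.induction_on' with
  | add f g hf hg =>
    obtain ⟨P₁, h₁⟩ := hf
    obtain ⟨P₂, h₂⟩ := hg
    exact ⟨P₁ + P₂, by simp only [map_add, Finset.sum_add_distrib, h₁, h₂]; ring⟩
  | monomial z c =>
    have hψ : IsPrimitiveRoot (ω ^ w) Q := hω.pow hQw (mul_comm _ _)
    have h1 : ∑ s ∈ Finset.range Q, aeval (ω ^ (1 + w * s)) (monomial z c) =
        c * ω ^ z * ∑ s ∈ Finset.range Q, ((ω ^ w) ^ z) ^ s := by
      rw [Finset.mul_sum]
      refine Finset.sum_congr rfl fun s _ => ?_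
      rw [aeval_monomial, algebraMap_int_eq, eq_intCast]
      ring
    -- By orthogonality only exponents `z` divisible by `Q` survive, so `1 + w * s` need not be
    -- prime to `Q`.
    rw [h1, hψ.sum_range_pow_pow]
    split_ifs
    · exact ⟨monomial z c, by rw [aeval_monomial, algebraMap_int_eq, eq_intCast]; ring⟩
    · exact ⟨0, by simp⟩

theorem exists_eq_mul_aeval_of_coprime {ω : ℂ} {k d : ℕ} (hkd : k.Coprime d) {C P : ℤ[X]}
    (h : k * aeval ω C = d * aeval ω P) : ∃ P' : ℤ[X], aeval ω C = d * aeval ω P' := by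
  obtain ⟨x, y, hxy⟩ := Nat.isCoprime_iff_coprime.2 hkd
  have hxy' : (x : ℂ) * k + y * d = 1 := by exact_mod_cast hxy
  refine ⟨x * P + y * C, ?_⟩
  simp only [map_add, map_mul, map_intCast]
  linear_combination (-aeval ω C) * hxy' + x * h

/-! ### Size bounds from divisible character sums. -/

/-- The polynomial `∑ X ^ (u * e i)`, over the `i < m` with `i ≠ 0` and `u ∣ i + y`. -/
noncomputable def fiberPolynomial (u m : ℕ) (e : ℕ → ℕ) (y : ℕ) : ℤ[X] :=
  ∑ i ∈ (Finset.range m).filter (fun i => u ∣ i + y), if i = 0 then 0 else X ^ (u * e i)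

theorem aeval_fiberPolynomial {u m : ℕ} {e : ℕ → ℕ} {a : ℕ → ℂ} {ω : ℂ} (ha0 : a 0 = 0)
    (ha : ∀ i, i ≠ 0 → i < m → a i = ω ^ (u * e i)) (y : ℕ) :
    aeval ω (fiberPolynomial u m e y) =
      ∑ i ∈ (Finset.range m).filter (fun i => u ∣ i + y), a i := by
  rw [fiberPolynomial, map_sum]
  refine Finset.sum_congr rfl fun i hi => ?_
  rcases eq_or_ne i 0 with rfl | h0
  · simp [ha0]
  · rw [ha i h0 (Finset.mem_range.1 (Finset.mem_filter.1 hi).1)]; simp [h0]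

theorem norm_aeval_fiberPolynomial_le {u M : ℕ} (hu : 0 < u) (e : ℕ → ℕ) {ω : ℂ} (hω : ‖ω‖ = 1)
    (y : ℕ) : ‖aeval ω (fiberPolynomial u (M * u) e y)‖ ≤ M := by
  rw [fiberPolynomial, map_sum]
  refine (norm_sum_le_of_le _ (n := fun _ => 1) fun i _ => ?_).trans ?_
  · split_ifs <;> simp [hω]
  · rw [Finset.sum_const, card_filter_range_dvd_add hu]; simp

/-- If all character sums of the sequence `a` at characters of order dividing `u` are divisible
by `d`, which is coprime to `u`, then `d` is at most `m / u`. -/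
theorem IsPrimitiveRoot.le_of_forall_dvd_characterSum {ω : ℂ} {u p M d : ℕ} {e : ℕ → ℕ}
    {a : ℕ → ℂ} (hu : 0 < u) (hp : 0 < p) (hω : IsPrimitiveRoot ω (u * p)) (hud : u.Coprime d)
    (ha0 : a 0 = 0) (ha : ∀ i, i ≠ 0 → i < M * u → a i = ω ^ (u * e i))
    (hdvd : ∀ k, ∃ P : ℤ[X],
      ∑ i ∈ Finset.range (M * u), a i * (ω ^ p) ^ (k * i) = d * aeval ω P)
    (hne : ∑ i ∈ Finset.range (M * u), a i * (ω ^ p) ^ i ≠ 0) : d ≤ M := by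
  by_contra! hlt
  have hN : 0 < u * p := Nat.mul_pos hu hp
  have hη : IsPrimitiveRoot (ω ^ p) u := hω.pow hN (mul_comm _ _)
  choose P hP using hdvd
  have hB : ∀ y, aeval ω (fiberPolynomial u (M * u) e y) = 0 := by
    intro y
    have h1 : (u : ℂ) * aeval ω (fiberPolynomial u (M * u) e y) =
        d * aeval ω (∑ k ∈ Finset.range u, X ^ (p * (k * y)) * P k) := by
      rw [aeval_fiberPolynomial ha0 ha,
        ← sum_characterSum_mul_eq (S := Finset.range u) (k := fun k => k) (η := ω ^ p)
          (fun j => by rw [← hη.sum_range_pow_pow j]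
                       exact Finset.sum_congr rfl fun k _ => by rw [mul_comm, pow_mul]),
        map_sum, Finset.mul_sum]
      refine Finset.sum_congr rfl fun k _ => ?_
      rw [hP, map_mul, map_pow, aeval_X, pow_mul]
      ring
    obtain ⟨P', hP'⟩ := exists_eq_mul_aeval_of_coprime hud h1
    refine hω.aeval_eq_zero_of_norm_lt hN hP' fun ω' hω' => ?_
    exact (norm_aeval_fiberPolynomial_le hu e (hω'.norm'_eq_one hN.ne') y).trans_lt
      (by exact_mod_cast hlt)
  apply hne
  have h := hη.sum_inv_pow_mul_fiberSum hu a (M * u) 0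
  simp_rw [← aeval_fiberPolynomial ha0 ha, hB] at h
  simpa using h.symm

/-- Version of `IsPrimitiveRoot.le_of_forall_dvd_characterSum` for a power `q ^ f` of a prime
divisor `q` of `u`. -/
theorem IsPrimitiveRoot.le_two_mul_of_forall_dvd_characterSum {ω : ℂ} {u p M q b w f : ℕ}
    {e : ℕ → ℕ} {a : ℕ → ℂ} (hq : q.Prime) (hp : 0 < p) (hw : 0 < w) (hqp : q.Coprime p)
    (hqw : q.Coprime w) (hu : u = q ^ (b + 1) * w) (hω : IsPrimitiveRoot ω (u * p))
    (ha0 : a 0 = 0) (ha : ∀ i, i ≠ 0 → i < M * u → a i = ω ^ (u * e i))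
    (hdvd : ∀ k, ∃ P : ℤ[X],
      ∑ i ∈ Finset.range (M * u), a i * (ω ^ p) ^ (k * i) = (q ^ f : ℕ) * aeval ω P)
    (hne : ∑ i ∈ Finset.range (M * u), a i * (ω ^ p) ^ i ≠ 0) : q ^ f ≤ 2 * M := by
  by_contra! hlt
  set m := M * u with hm
  set Q := q ^ (b + 1) with hQ
  set h := q ^ b * w with hh
  have hQ0 : 0 < Q := pow_pos hq.pos _
  have hu0 : 0 < u := hu ▸ Nat.mul_pos hQ0 hw
  have hN : 0 < u * p := Nat.mul_pos hu0 hp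
  have hqh : q * h = u := by rw [hu, hQ, hh]; ring
  have hη : IsPrimitiveRoot (ω ^ p) u := hω.pow hN (mul_comm _ _)
  have hη1 : IsPrimitiveRoot ((ω ^ p) ^ Q) w := hη.pow hu0 hu
  have hη2 : IsPrimitiveRoot ((ω ^ p) ^ (w * p)) Q := by
    rw [pow_mul]
    exact (hη.pow hu0 (by rw [hu, mul_comm])).pow_of_coprime p
      (Nat.Coprime.pow_right _ hqp.symm)
  -- By the Chinese remainder theorem these exponents meet each class modulo `u` once. Moving `s`
  -- corresponds to `ω ↦ ω ^ (1 + w * p * s)`, which fixes the `p`-th and `w`-th roots of unity.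
  let k : ℕ × ℕ → ℕ := fun x => 1 + Q * x.1 + w * p * x.2
  have hk : ∀ j, ∑ x ∈ Finset.range w ×ˢ Finset.range Q, (ω ^ p) ^ (k x * j) =
      if u ∣ j then (u : ℂ) else 0 := by
    intro j
    have h1 : ∑ x ∈ Finset.range w ×ˢ Finset.range Q, (ω ^ p) ^ (k x * j) =
        (ω ^ p) ^ j * ((∑ t ∈ Finset.range w, (((ω ^ p) ^ Q) ^ j) ^ t) *
          ∑ s ∈ Finset.range Q, (((ω ^ p) ^ (w * p)) ^ j) ^ s) := by
      rw [Finset.sum_mul_sum, Finset.sum_product, Finset.mul_sum]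
      refine Finset.sum_congr rfl fun t _ => ?_
      rw [Finset.mul_sum]
      refine Finset.sum_congr rfl fun s _ => ?_
      simp only [k, ← pow_mul, ← pow_add]
      congr 1
      ring
    have h2 : u ∣ j ↔ w ∣ j ∧ Q ∣ j := by
      rw [hu, mul_comm]
      exact ⟨fun h => ⟨dvd_of_mul_right_dvd h, dvd_of_mul_left_dvd h⟩, fun h =>
        Nat.Coprime.mul_dvd_of_dvd_of_dvd (Nat.Coprime.pow_right _ hqw.symm) h.1 h.2⟩
    rw [h1, hη1.sum_range_pow_pow, hη2.sum_range_pow_pow]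
    by_cases hj : u ∣ j
    · rw [if_pos hj, if_pos (h2.1 hj).1, if_pos (h2.1 hj).2, (hη.pow_eq_one_iff_dvd j).2 hj, hu]
      push_cast; ring
    · rw [if_neg hj]
      by_cases hj1 : w ∣ j
      · rw [if_neg fun hj2 => hj (h2.2 ⟨hj1, hj2⟩)]; ring
      · rw [if_neg hj1]; ring
  set χ : ℕ → ℂ := fun l => ∑ i ∈ Finset.range m, a i * (ω ^ p) ^ (l * i) with hχ
  choose P hP using hdvd
  let S : ℕ → ℤ[X] := fun t => ∑ i ∈ Finset.range m,
    (if i = 0 then 0 else X ^ (u * e i)) * X ^ (p * ((1 + Q * t) * i))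
  have hS : ∀ t s, aeval (ω ^ (1 + w * p * s)) (S t) = χ (k (t, s)) := by
    intro t s
    simp only [S, hχ, map_sum, map_mul, map_pow, aeval_X]
    refine Finset.sum_congr rfl fun i hi => ?_
    rcases eq_or_ne i 0 with rfl | h0
    · simp [ha0]
    · rw [if_neg h0, ha i h0 (Finset.mem_range.1 hi), map_pow, aeval_X]
      have e1 : (ω ^ (1 + w * p * s)) ^ (u * e i) = ω ^ (u * e i) := by
        calc _ = ω ^ (u * e i) * (ω ^ (u * p)) ^ (w * s * e i) := by ring
          _ = _ := by rw [hω.pow_eq_one, one_pow, mul_one]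
      have e2 : (ω ^ (1 + w * p * s)) ^ (p * ((1 + Q * t) * i)) = (ω ^ p) ^ (k (t, s) * i) := by
        calc _ = (ω ^ p) ^ (k (t, s) * i) * (ω ^ (Q * w * p)) ^ (p * t * s * i) := by
              simp only [k]; ring
          _ = _ := by rw [← hu, hω.pow_eq_one, one_pow, mul_one]
      rw [e1, e2]
  have hSP : ∀ t, aeval ω (S t) = ((q ^ f : ℕ) : ℂ) * aeval ω (P (1 + Q * t)) := by
    intro t
    have h0 := hS t 0
    simp only [mul_zero, add_zero, pow_one] at h0
    rw [h0, ← hP]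
    simp [hχ, k]
  let E : ℕ → ℕ → ℤ[X] := fun y t =>
    X ^ (p * ((1 + Q * t) * y)) * (1 - X ^ (p * ((1 + Q * t) * h))) * P (1 + Q * t)
  have hE : ∀ y t s, ((ω ^ p) ^ (k (t, s) * y) - (ω ^ p) ^ (k (t, s) * (y + h))) * χ (k (t, s)) =
      ((q ^ f : ℕ) : ℂ) * aeval (ω ^ (1 + w * p * s)) (E y t) := by
    intro y t s
    have e2 : ∀ z, (ω ^ p) ^ (k (t, s) * z) =
        (ω ^ (1 + w * p * s)) ^ (p * ((1 + Q * t) * z)) := by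
      intro z
      symm
      calc _ = (ω ^ p) ^ (k (t, s) * z) * (ω ^ (Q * w * p)) ^ (p * t * s * z) := by
            simp only [k]; ring
        _ = _ := by rw [← hu, hω.pow_eq_one, one_pow, mul_one]
    simp only [E, map_mul, map_sub, map_one, map_pow, aeval_X]
    -- If `q` divides the exponent, `ω ↦ ω ^ (1 + w * p * s)` is no conjugation, but the factor `1 -
    -- X ^ …` vanishes on both sides because `q * h = u`.
    by_cases hqs : q ∣ 1 + w * p * s
    · obtain ⟨c, hc⟩ := hqs
      have e3 : (ω ^ (1 + w * p * s)) ^ (p * ((1 + Q * t) * h)) = 1 := by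
        calc _ = (ω ^ (q * h * p)) ^ (c * (1 + Q * t)) := by rw [hc]; ring
          _ = _ := by rw [hqh, hω.pow_eq_one, one_pow]
      rw [mul_add, pow_add, e2 h, e3]
      ring
    · have hcop : (1 + w * p * s).Coprime (u * p) := by
        have c1 : (1 + w * p * s).Coprime (w * p) := by simp
        have c2 : (1 + w * p * s).Coprime Q :=
          Nat.Coprime.pow_right _ ((hq.coprime_iff_not_dvd.2 hqs).symm)
        have c3 := c2.mul_right c1
        rwa [← mul_assoc Q w p, ← hu] at c3
      have e4 := hω.aeval_pow_eq_mul hN (k := ((q ^ f : ℕ) : ℤ)) (by simp) (hSP t) hcop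
      rw [← hS t s, e4, e2, e2, mul_add, mul_add, pow_add]
      ring
  have hω' : IsPrimitiveRoot ω (Q * (w * p)) := by rw [← mul_assoc, ← hu]; exact hω
  have hQwp : 0 < Q * (w * p) := Nat.mul_pos hQ0 (Nat.mul_pos hw hp)
  have hB : ∀ y,
      aeval ω (fiberPolynomial u m e y) - aeval ω (fiberPolynomial u m e (y + h)) = 0 := by
    intro y
    choose T hT using fun t => hω'.exists_sum_aeval_eq_mul hQwp (E y t)
    have h1 : (w : ℂ) * aeval ω (fiberPolynomial u m e y - fiberPolynomial u m e (y + h)) =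
        ((q ^ f : ℕ) : ℂ) * aeval ω (∑ t ∈ Finset.range w, T t) := by
      -- Inversion gives a factor `u = Q * w`; the trace over `s` supplies `Q`, which cancels and
      -- leaves only `w`, prime to `q`.
      have hQ0' : (Q : ℂ) ≠ 0 := by exact_mod_cast hQ0.ne'
      apply mul_left_cancel₀ hQ0'
      have i1 := sum_characterSum_mul_eq hk a m y
      have i2 := sum_characterSum_mul_eq hk a m (y + h)
      rw [← aeval_fiberPolynomial ha0 ha] at i1 i2
      have hu' : (u : ℂ) = Q * w := by rw [hu]; push_cast; ring
      calc (Q : ℂ) * (w * aeval ω (fiberPolynomial u m e y - fiberPolynomial u m e (y + h)))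
          = ∑ x ∈ Finset.range w ×ˢ Finset.range Q,
            ((ω ^ p) ^ (k x * y) - (ω ^ p) ^ (k x * (y + h))) * χ (k x) := by
            simp_rw [sub_mul]
            rw [Finset.sum_sub_distrib, i1, i2, hu', map_sub]
            ring
        _ = ∑ t ∈ Finset.range w, ∑ s ∈ Finset.range Q,
            ((q ^ f : ℕ) : ℂ) * aeval (ω ^ (1 + w * p * s)) (E y t) := by
            rw [Finset.sum_product]
            exact Finset.sum_congr rfl fun t _ => Finset.sum_congr rfl fun s _ => hE y t s
        _ = _ := by
            simp_rw [← Finset.mul_sum, hT]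
            rw [← Finset.mul_sum, map_sum]
            ring
    obtain ⟨P', hP'⟩ := exists_eq_mul_aeval_of_coprime (Nat.Coprime.pow_right f hqw.symm) h1
    rw [← map_sub]
    refine hω.aeval_eq_zero_of_norm_lt hN hP' fun ω' hω' => ?_
    have hn := hω'.norm'_eq_one hN.ne'
    rw [map_sub]
    calc _ ≤ ‖aeval ω' (fiberPolynomial u m e y)‖ + ‖aeval ω' (fiberPolynomial u m e (y + h))‖ :=
          norm_sub_le _ _
      _ ≤ M + M := add_le_add (norm_aeval_fiberPolynomial_le hu0 e hn y)
          (norm_aeval_fiberPolynomial_le hu0 e hn (y + h))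
      _ < _ := by rw [← two_mul]; exact_mod_cast hlt
  have h0 := hη.sum_inv_pow_mul_fiberSum hu0 a m 0
  have h1 := hη.sum_inv_pow_mul_fiberSum hu0 a m h
  simp_rw [← aeval_fiberPolynomial ha0 ha] at h0 h1
  simp_rw [← sub_eq_zero.1 (hB _)] at h1
  simp only [add_zero, pow_zero, one_mul] at h0
  rw [h0] at h1
  -- The fibre sums have period `h = u / q`, and `χ 1 ≠ 0`; this contradicts the order `u` of `ω ^
  -- p`.
  have h2 : (ω ^ p) ^ h = 1 := (mul_right_cancel₀ hne (by rw [one_mul]; exact h1)).symm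
  have h3 : u ∣ h := (hη.pow_eq_one_iff_dvd h).1 h2
  have h4 : 0 < h := Nat.mul_pos (pow_pos hq.pos _) hw
  have h5 := Nat.le_of_dvd h4 h3
  rw [← hqh] at h5
  nlinarith [hq.two_le]

/-! ### Character sums of nearly perfect sequences. -/

theorem Function.Periodic.sum_range_add {g : ℕ → ℂ} {m : ℕ} (hg : Function.Periodic g m) (i : ℕ) :
    ∑ t ∈ Finset.range m, g (i + t) = ∑ t ∈ Finset.range m, g t := by
  induction i with
  | zero => simp
  | succ i ih =>
    rw [← ih]
    have h1 := Finset.sum_range_succ (fun t => g (i + t)) m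
    rw [Finset.sum_range_succ', hg i] at h1
    simp only [add_zero] at h1
    rw [← add_right_cancel h1]
    exact Finset.sum_congr rfl fun t _ => by congr 1; ring

theorem characterSum_mul_conj {m : ℕ} {a : ℕ → ℂ} (ha : Function.Periodic a m) {z : ℂ}
    (hm : m ≠ 0) (hz : z ^ m = 1) :
    (∑ i ∈ Finset.range m, a i * z ^ i) * (starRingEnd ℂ) (∑ i ∈ Finset.range m, a i * z ^ i) =
      ∑ t ∈ Finset.range m, (starRingEnd ℂ) (z ^ t) * autocorrelation m a t := by
  have hzz : z * (starRingEnd ℂ) z = 1 := by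
    rw [Complex.mul_conj, Complex.normSq_eq_norm_sq, Complex.norm_eq_one_of_pow_eq_one hz hm]
    simp
  have hper : Function.Periodic (fun i => (starRingEnd ℂ) (a i * z ^ i)) m := by
    intro i
    simp only [ha i, pow_add, hz, mul_one]
  rw [map_sum, Finset.sum_mul_sum]
  simp only [autocorrelation, Finset.mul_sum]
  conv_rhs => rw [Finset.sum_comm]
  refine Finset.sum_congr rfl fun i _ => ?_
  rw [← Finset.mul_sum, ← hper.sum_range_add i, Finset.mul_sum]
  refine Finset.sum_congr rfl fun t _ => ?_
  have h1 : z ^ i * (starRingEnd ℂ) z ^ i = 1 := by rw [← mul_pow, hzz, one_pow]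
  simp only [map_mul, map_pow, pow_add]
  linear_combination (a i * (starRingEnd ℂ) (a (i + t)) * (starRingEnd ℂ) z ^ t) * h1

theorem IsAlmostAryNPS.characterSum_mul_conj {p n : ℕ} {γ : ℤ} {a : ℕ → ℂ}
    (h : IsAlmostAryNPS p (n + 1) γ a) (hp : p ≠ 0) {z : ℂ} (hz : z ^ (n + 1) = 1) :
    (∑ i ∈ Finset.range (n + 1), a i * z ^ i) *
        (starRingEnd ℂ) (∑ i ∈ Finset.range (n + 1), a i * z ^ i) =
      ((if z = 1 then (γ + 1) * n else n - γ : ℤ) : ℂ) := by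
  obtain ⟨⟨hper, ha0, ζ, hζ, ha⟩, hcor⟩ := h
  rw [_root_.characterSum_mul_conj hper n.succ_ne_zero hz, Finset.sum_range_succ']
  have h0 : autocorrelation (n + 1) a 0 = n := by
    have h1 : ∀ i ∈ Finset.range n, a (i + 1) * (starRingEnd ℂ) (a (i + 1)) = 1 := by
      intro i hi
      obtain ⟨b, hb⟩ := ha (i + 1) (by omega) (by have := Finset.mem_range.1 hi; omega)
      rw [hb, Complex.mul_conj, Complex.normSq_eq_norm_sq, norm_zpow, hζ.norm'_eq_one hp]
      simp
    rw [autocorrelation, Finset.sum_range_succ']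
    simp only [add_zero, ha0, zero_mul]
    rw [Finset.sum_congr rfl h1]
    simp
  have h2 : ∀ t ∈ Finset.range n,
      (starRingEnd ℂ) (z ^ (t + 1)) * autocorrelation (n + 1) a (t + 1) =
        γ * (starRingEnd ℂ) (z ^ (t + 1)) := by
    intro t ht
    rw [hcor (t + 1) (by omega) (by have := Finset.mem_range.1 ht; omega), mul_comm]
  rw [Finset.sum_congr rfl h2, h0, ← Finset.mul_sum, ← map_sum]
  have h3 := Finset.sum_range_succ' (fun t => z ^ t) n
  by_cases hz1 : z = 1
  · simp [hz1]; ring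
  · rw [if_neg hz1]
    rw [geom_sum_eq hz1, hz, sub_self, zero_div, pow_zero] at h3
    rw [eq_neg_of_add_eq_zero_left h3.symm]
    simp; ring

/-- The values of the sequence and of its character sums lie in the ring generated by a primitive
`u * p`-th root of unity. -/
theorem IsAlmostAryNPS.exists_isPrimitiveRoot {p n u : ℕ} {γ : ℤ} {a : ℕ → ℂ}
    (h : IsAlmostAryNPS p (n + 1) γ a) (hp : p ≠ 0) (hu : u ≠ 0) :
    ∃ (ω : ℂ) (e : ℕ → ℕ), IsPrimitiveRoot ω (u * p) ∧
      (∀ i, i ≠ 0 → i < n + 1 → a i = ω ^ (u * e i)) ∧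
      ∀ k, ∃ C : ℤ[X],
        ∑ i ∈ Finset.range (n + 1), a i * (ω ^ p) ^ (k * i) = aeval ω C := by
  obtain ⟨⟨-, ha0, ζ, hζ, ha⟩, -⟩ := h
  have hN : u * p ≠ 0 := mul_ne_zero hu hp
  have hω := Complex.isPrimitiveRoot_exp (u * p) hN
  set ω := Complex.exp (2 * Real.pi * Complex.I / (u * p : ℕ)) with hωdef
  have hωu : IsPrimitiveRoot (ω ^ u) p := hω.pow (Nat.pos_of_ne_zero hN) rfl
  have hpos : NeZero p := ⟨hp⟩
  have hex : ∀ i, ∃ c : ℕ, i ≠ 0 → i < n + 1 → a i = ω ^ (u * c) := by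
    intro i
    by_cases hi : i ≠ 0 ∧ i < n + 1
    · obtain ⟨b, hb⟩ := ha i (Nat.one_le_iff_ne_zero.2 hi.1) hi.2
      obtain ⟨c, -, hc⟩ := hωu.eq_pow_of_pow_eq_one (ξ := a i) (by
        rw [hb, ← zpow_natCast, ← zpow_mul, mul_comm, zpow_mul, zpow_natCast, hζ.pow_eq_one,
          one_zpow])
      exact ⟨c, fun _ _ => by rw [pow_mul, hc]⟩
    · exact ⟨0, fun h1 h2 => absurd ⟨h1, h2⟩ hi⟩
  choose e he using hex
  refine ⟨ω, e, hω, he, fun k => ⟨∑ i ∈ Finset.range (n + 1),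
    (if i = 0 then 0 else X ^ (u * e i)) * X ^ (p * (k * i)), ?_⟩⟩
  rw [map_sum]
  refine Finset.sum_congr rfl fun i hi => ?_
  rcases eq_or_ne i 0 with rfl | h0
  · simp [ha0]
  · rw [he i h0 (Finset.mem_range.1 hi)]
    simp [h0, pow_mul]

theorem IsSelfConjugateMod.exists_pow_modEq {q v : ℕ} (h : IsSelfConjugateMod q v)
    (hv : ¬ q ∣ v) : ∃ j : ℕ, (q : ℤ) ^ j ≡ -1 [ZMOD (v : ℤ)] := by
  obtain ⟨s, w, rfl, hqw, j, hj⟩ := h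
  rcases s with _ | s
  · exact ⟨j, by simpa using hj⟩
  · exact absurd ((dvd_pow_self q s.succ_ne_zero).mul_right w) hv

/-- If the squared absolute value of one character sum is exactly divisible by `q ^ r`, then `r`
is even. -/
theorem IsAlmostAryNPS.even_of_exactlyDivides {p n u q r k : ℕ} {γ : ℤ} {a : ℕ → ℂ}
    (h : IsAlmostAryNPS p (n + 1) γ a) (hp : p.Prime) (hq : q.Prime) (hqp : q ≠ p) (hu0 : u ≠ 0)
    (hu : u ∣ n + 1) (hqu : ¬ q ∣ u) (hsc : IsSelfConjugateMod q (u * p))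
    (hr : ExactlyDivides q r (if u ∣ k then (γ + 1) * n else n - γ)) : Even r := by
  obtain ⟨ω, e, hω, -, hC⟩ := h.exists_isPrimitiveRoot hp.ne_zero hu0
  obtain ⟨C, hC⟩ := hC k
  have hη : IsPrimitiveRoot (ω ^ p) u :=
    hω.pow (Nat.mul_pos (Nat.pos_of_ne_zero hu0) hp.pos) (mul_comm _ _)
  have hcop : q.Coprime (u * p) :=
    (hq.coprime_iff_not_dvd.2 hqu).mul_right ((Nat.coprime_primes hq hp).2 hqp)
  obtain ⟨j, hj⟩ := hsc.exists_pow_modEq (hq.coprime_iff_not_dvd.1 hcop)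
  refine hω.even_of_mul_conj hq hcop hj (C := C) ?_ hr
  have hz : ((ω ^ p) ^ k) ^ (n + 1) = 1 := by
    obtain ⟨M, hM⟩ := hu
    rw [hM, ← pow_mul, mul_left_comm, pow_mul, hη.pow_eq_one, one_pow]
  have h1 := h.characterSum_mul_conj hp.ne_zero hz
  simp only [hη.pow_eq_one_iff_dvd, ← pow_mul (ω ^ p)] at h1
  rw [← hC, h1]

/-- Bounds for a prime power `q ^ r` dividing the squared absolute value of all character sums. -/
theorem IsAlmostAryNPS.pow_le_of_dvd {p n u q r : ℕ} {γ : ℤ} {a : ℕ → ℂ}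
    (h : IsAlmostAryNPS p (n + 1) γ a) (hp : p.Prime) (hq : q.Prime) (hqp : q ≠ p) (hu0 : u ≠ 0)
    (hu : u ∣ n + 1) (hsc : IsSelfConjugateMod q (u * p))
    (hr : ∀ k, (q : ℤ) ^ r ∣ if u ∣ k then (γ + 1) * n else n - γ)
    (hne : (if u ∣ 1 then (γ + 1) * n else n - γ : ℤ) ≠ 0) :
    (q : ℝ) ^ (r / 2) ≤ (if q ∣ u then 2 else 1) * (((n : ℝ) + 1) / (u : ℝ)) := by
  obtain ⟨ω, e, hω, hae, hC⟩ := h.exists_isPrimitiveRoot hp.ne_zero hu0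
  have ha0 : a 0 = 0 := h.1.2.1
  choose C hC using hC
  have hη : IsPrimitiveRoot (ω ^ p) u :=
    hω.pow (Nat.mul_pos (Nat.pos_of_ne_zero hu0) hp.pos) (mul_comm _ _)
  obtain ⟨M, hM⟩ := hu
  rw [mul_comm] at hM
  have hX : ∀ k, aeval ω (C k) * (starRingEnd ℂ) (aeval ω (C k)) =
      ((if u ∣ k then (γ + 1) * n else n - γ : ℤ) : ℂ) := by
    intro k
    have hz : ((ω ^ p) ^ k) ^ (n + 1) = 1 := by
      rw [hM, ← pow_mul, ← mul_assoc, mul_comm, pow_mul, hη.pow_eq_one, one_pow]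
    have h1 := h.characterSum_mul_conj hp.ne_zero hz
    simp only [hη.pow_eq_one_iff_dvd, ← pow_mul (ω ^ p)] at h1
    rw [← hC, h1]
  have hne' : ∑ i ∈ Finset.range (n + 1), a i * (ω ^ p) ^ i ≠ 0 := by
    intro h0
    have h1 := hX 1
    rw [← hC] at h1
    simp only [one_mul] at h1
    rw [h0, zero_mul] at h1
    exact hne (by exact_mod_cast h1.symm)
  have hdiv : ((n : ℝ) + 1) / u = M := by
    have : (u : ℝ) ≠ 0 := by exact_mod_cast hu0
    rw [div_eq_iff this]
    exact_mod_cast hM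
  have hcop := (Nat.coprime_primes hq hp).2 hqp
  rw [hdiv]
  obtain ⟨s, w₀, hs, hqw, j, hj⟩ := hsc
  have hd : ∀ k, ∃ P : ℤ[X], ∑ i ∈ Finset.range (n + 1), a i * (ω ^ p) ^ (k * i) =
      ((q ^ (r / 2) : ℕ) : ℂ) * aeval ω P := by
    intro k
    obtain ⟨P, hP⟩ := hω.exists_eq_pow_mul_of_mul_conj hq hs hqw hj (hX k) (hr k)
    -- When `s = 0` the available exponent is `(r + 1) / 2`; the surplus goes into the cofactor.
    refine ⟨(q : ℤ[X]) ^ ((if s = 0 then (r + 1) / 2 else r / 2) - r / 2) * P, ?_⟩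
    rw [hC, hP, map_mul, map_pow, map_natCast, ← mul_assoc]
    push_cast
    rw [← pow_add]
    congr 2
    split_ifs <;> omega
  rw [hM] at hae hd hne'
  by_cases hqu : q ∣ u
  · rw [if_pos hqu]
    obtain ⟨w, rfl⟩ : p ∣ w₀ := by
      refine Nat.Coprime.dvd_of_dvd_mul_left (Nat.Coprime.pow_right s hcop.symm) ?_
      exact hs ▸ Dvd.intro_left u rfl
    have hu' : u = q ^ s * w := Nat.eq_of_mul_eq_mul_right hp.pos (by rw [hs]; ring)
    have hqw' : q.Coprime w := Nat.Coprime.coprime_mul_left_right hqw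
    rcases s with _ | b
    · rw [hu', pow_zero, one_mul] at hqu
      exact absurd hqu (hq.coprime_iff_not_dvd.1 hqw')
    · have hw : 0 < w := Nat.pos_of_ne_zero fun h0 => hu0 (by rw [hu', h0, mul_zero])
      have := hω.le_two_mul_of_forall_dvd_characterSum hq hp.pos hw hcop hqw' hu' ha0 hae hd hne'
      exact_mod_cast this
  · rw [if_neg hqu, one_mul]
    have := hω.le_of_forall_dvd_characterSum (Nat.pos_of_ne_zero hu0) hp.pos
      (Nat.Coprime.pow_right _ (hq.coprime_iff_not_dvd.2 hqu).symm) ha0 hae hd hne'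
    exact_mod_cast this

theorem theorem4 (p : ℕ) (hp : p.Prime) (n : ℕ) (hn : 0 < n) (γ : ℤ) (hγ : |γ| < (n : ℤ))
    (hex : ∃ a : ℕ → ℂ, IsAlmostAryNPS p (n + 1) γ a) :
    -- (i)
    (γ = 0 → ∀ q r u : ℕ, q.Prime → q ≠ p → q ∣ n → ExactlyDivides q r (n : ℤ) →
      1 ≤ u → u ∣ n + 1 → IsSelfConjugateMod q (u * p) →
        Even r ∧ (q : ℝ) ^ (r / 2) ≤ ((n : ℝ) + 1) / (u : ℝ)) ∧
    -- (ii)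
    (γ = -1 → ∀ q r u : ℕ, q.Prime → q ≠ p → (q : ℤ) ∣ (n : ℤ) - γ →
      ExactlyDivides q r ((n : ℤ) - γ) →
      1 < u → u ∣ n + 1 → IsSelfConjugateMod q (u * p) →
        (¬ q ∣ u → Even r ∧ (q : ℝ) ^ (r / 2) ≤ ((n : ℝ) + 1) / (u : ℝ)) ∧
        (q ∣ u → (q : ℝ) ^ (r / 2) ≤ 2 * (((n : ℝ) + 1) / (u : ℝ)))) ∧
    -- (iii)
    (γ ≠ 0 →
      (∀ q r u : ℕ, q.Prime → q ≠ p → (q : ℤ) ∣ (γ + 1) * (n : ℤ) →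
        ExactlyDivides q r ((γ + 1) * (n : ℤ)) →
        1 ≤ u → u ∣ n + 1 → IsSelfConjugateMod q (u * p) → ¬ q ∣ u → Even r) ∧
      (∀ q r u : ℕ, q.Prime → q ≠ p → (q : ℤ) ∣ (n : ℤ) - γ →
        ExactlyDivides q r ((n : ℤ) - γ) →
        1 < u → u ∣ n + 1 → IsSelfConjugateMod q (u * p) → ¬ q ∣ u → Even r)) := by
  obtain ⟨a, ha⟩ := hex
  have hn1 : ∀ u : ℕ, 1 < u → ¬ u ∣ 1 := fun u hu h => hu.ne' (Nat.dvd_one.1 h)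
  refine ⟨?_, ?_, ?_⟩
  -- Here `q ∣ n` excludes `q ∣ n + 1`, hence `q ∣ u`.
  · rintro rfl q r u hq hqp hqn hr hu1 hu hsc
    have hqu : ¬ q ∣ u := fun h =>
      hq.one_lt.ne' (Nat.dvd_one.1 ((Nat.dvd_add_right hqn).1 (h.trans hu)))
    have hval : ∀ k, (if u ∣ k then (0 + 1) * (n : ℤ) else n - 0) = n := fun k => by simp
    refine ⟨ha.even_of_exactlyDivides (k := 0) hp hq hqp (by omega) hu hqu hsc
      (by rw [hval]; exact hr), ?_⟩
    have := ha.pow_le_of_dvd (r := r) hp hq hqp (by omega) hu hsc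
      (fun k => by rw [hval]; exact hr.1) (by rw [hval]; exact_mod_cast hn.ne')
    rwa [if_neg hqu, one_mul] at this
  -- The trivial character sum vanishes as `γ + 1 = 0`, so it is divisible by every `q ^ r`; `u > 1`
  -- makes the character with `k = 1` nontrivial.
  · rintro rfl q r u hq hqp hqn hr hu1 hu hsc
    have hle := ha.pow_le_of_dvd (r := r) hp hq hqp (by omega) hu hsc
      (fun k => by
        split_ifs
        · simp
        · exact hr.1)
      (by rw [if_neg (hn1 u hu1)]; omega)
    refine ⟨fun hqu => ⟨ha.even_of_exactlyDivides (k := 1) hp hq hqp (by omega) hu hqu hsc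
      (by rw [if_neg (hn1 u hu1)]; exact hr), ?_⟩, fun hqu => ?_⟩
    · rwa [if_neg hqu, one_mul] at hle
    · rwa [if_pos hqu] at hle
  · refine fun _ => ⟨?_, ?_⟩
    · intro q r u hq hqp _ hr hu1 hu hsc hqu
      exact ha.even_of_exactlyDivides (k := 0) hp hq hqp (by omega) hu hqu hsc
        (by rw [if_pos (dvd_zero u)]; exact hr)
    · intro q r u hq hqp _ hr hu1 hu hsc hqu
      exact ha.even_of_exactlyDivides (k := 1) hp hq hqp (by omega) hu hqu hsc
        (by rw [if_neg (hn1 u hu1)]; exact hr)
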